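/- Let $k$ be a field of prime characteristic $p>0$ and let $$R=\frac{k[t,u,v,w,x,y,z]}{(u^2x^2+v^2y^2+tuxvy+tw^2z^2)}.$$ Then the set $$\bigcup_{q=p^e,\ e\in\mathbb{N}} \operatorname{Ass}_R \frac{R}{(u^q,v^q,w^q,x^q,y^q,z^q)}$$ of prime ideals of $R$ is infinite; moreover, it has infinitely many elements that are maximal (with respect to inclusion) among the elements of this set. -/

import Mathlib

noncomputable section

namespace SinghSwanson

/-- The polynomial `u²x² + v²y² + tuxvy + tw²z²` in `k[t,u,v,w,x,y,z]`, where the variables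
`t, u, v, w, x, y, z` are `X 0, X 1, X 2, X 3, X 4, X 5, X 6` in this order. -/
def equation (k : Type*) [Field k] : MvPolynomial (Fin 7) k :=
  let t := MvPolynomial.X 0
  let u := MvPolynomial.X 1
  let v := MvPolynomial.X 2
  let w := MvPolynomial.X 3
  let x := MvPolynomial.X 4
  let y := MvPolynomial.X 5
  let z := MvPolynomial.X 6
  u ^ 2 * x ^ 2 + v ^ 2 * y ^ 2 + t * u * x * v * y + t * w ^ 2 * z ^ 2

/-- The hypersurface ring `R = k[t,u,v,w,x,y,z] / (u²x² + v²y² + tuxvy + tw²z²)`. -/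
abbrev HypersurfaceRing (k : Type*) [Field k] : Type _ :=
  MvPolynomial (Fin 7) k ⧸ Ideal.span {equation k}

/-- The class in `R` of the `i`-th variable, in the order `t, u, v, w, x, y, z`. -/
def coord (k : Type*) [Field k] (i : Fin 7) : HypersurfaceRing k :=
  Ideal.Quotient.mk (Ideal.span {equation k}) (MvPolynomial.X i)

/-- The ideal `(u^q, v^q, w^q, x^q, y^q, z^q)` of `R`. -/
def powerIdeal (k : Type*) [Field k] (q : ℕ) : Ideal (HypersurfaceRing k) :=
  Ideal.span {coord k 1 ^ q, coord k 2 ^ q, coord k 3 ^ q,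
    coord k 4 ^ q, coord k 5 ^ q, coord k 6 ^ q}

/-- The union over all `q = p^e`, `e ∈ ℕ`, of the sets of associated primes of the `R`-module
`R / (u^q, v^q, w^q, x^q, y^q, z^q)`. -/
def assUnion (k : Type*) [Field k] (p : ℕ) : Set (Ideal (HypersurfaceRing k)) :=
  ⋃ e : ℕ, associatedPrimes (HypersurfaceRing k) (HypersurfaceRing k ⧸ powerIdeal k (p ^ e))

end SinghSwanson

end

namespace SinghSwanson

open MvPolynomial

/-! Fix n ≥ 2 and q = c + n, and let s be the continuant sequence. Modulo the power ideal, the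
monomials Mⱼ = u^(c+j) x^j v^(c+n-j) y^(n-j) w^(q-1) satisfy Mⱼ₊₂ + t Mⱼ₊₁ + Mⱼ = 0, with M₀ = Mₙ =
0. Hence Mⱼ = sⱼ(t) M₁, and sₙ(t) kills M₁. A linear functional into k[t]/(sₙ) shows that M₁ ≠ 0, so
some associated prime contains sₙ(t). It also contains u, …, z, so it is a maximal ideal. For
coprime m and n no proper ideal contains both sₘ(t) and sₙ(t), so prime indices n give distinct
primes. -/

/-- The continuant sequence `0, 1, -a, a² - 1, …` satisfying `sₙ₊₂ + a sₙ₊₁ + sₙ = 0`. -/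
def continuant {A : Type*} [CommRing A] (a : A) : ℕ → A
  | 0 => 0
  | 1 => 1
  | n + 2 => -a * continuant a (n + 1) - continuant a n

/-! ### Gcd property and degree of continuants -/

section Continuant

variable {A B : Type*} [CommRing A] [CommRing B]

theorem continuant_recurrence (a : A) (n : ℕ) :
    continuant a (n + 2) + a * continuant a (n + 1) + continuant a n = 0 := by
  rw [continuant]; ring

theorem map_continuant (f : A →+* B) (a : A) (n : ℕ) :
    f (continuant a n) = continuant (f a) n := by
  induction n using Nat.twoStepInduction with
  | zero => simp [continuant]
  | one => simp [continuant]
  | more n ih₀ ih₁ => simp [continuant, ih₀, ih₁]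

theorem continuant_add (a : A) (m n : ℕ) :
    continuant a (n + 1 + m) =
      continuant a (n + 1) * continuant a (m + 1) - continuant a n * continuant a m := by
  induction m using Nat.twoStepInduction with
  | zero => simp [continuant]
  | one => simp [continuant]; ring
  | more m ih₀ ih₁ =>
    have h := continuant_recurrence a (n + 1 + m)
    have h₁ := continuant_recurrence a (m + 1)
    have h₀ := continuant_recurrence a m
    rw [show n + 1 + m + 1 = n + 1 + (m + 1) by ring, ih₀, ih₁] at h
    rw [show n + 1 + (m + 2) = n + 1 + m + 2 by ring]
    linear_combination h - continuant a (n + 1) * h₁ + continuant a n * h₀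

theorem continuant_sq_sub (a : A) (n : ℕ) :
    continuant a (n + 1) ^ 2 - continuant a n * continuant a (n + 2) = 1 := by
  induction n with
  | zero => simp [continuant]
  | succ n ih =>
    have h₁ := continuant_recurrence a (n + 1)
    have h₀ := continuant_recurrence a n
    linear_combination ih - continuant a (n + 1) * h₁ + continuant a (n + 2) * h₀

/-- If sₘ = 0, then `continuant_sq_sub` makes sₘ₊₁ a unit and the addition formula gives s_(N+1+m) =
s_(N+1) sₘ₊₁, so a shift by m can be undone. -/
theorem continuant_eq_zero_of_add_mul {a : A} {m n : ℕ} (hm : continuant a m = 0) (k : ℕ)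
    (h : continuant a (n + k * m) = 0) : continuant a n = 0 := by
  induction k with
  | zero => simpa using h
  | succ k ih =>
    apply ih
    rw [add_mul, one_mul, ← add_assoc] at h
    generalize n + k * m = N at h
    cases N with
    | zero => rfl
    | succ N =>
      have h₁ := continuant_sq_sub a m
      rw [continuant_add, hm] at h
      rw [hm] at h₁
      linear_combination continuant a (m + 1) * h - continuant a (N + 1) * h₁

theorem continuant_gcd_eq_zero {a : A} (m n : ℕ) (hm : continuant a m = 0)
    (hn : continuant a n = 0) : continuant a (m.gcd n) = 0 := by
  induction m, n using Nat.gcd.induction with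
  | H0 n => simpa using hn
  | H1 m n _ ih =>
    rw [Nat.gcd_rec]
    refine ih (continuant_eq_zero_of_add_mul hm (n / m) ?_) hm
    rwa [mul_comm, Nat.mod_add_div]

theorem not_coprime_of_continuant_eq_zero [Nontrivial A] {a : A} {m n : ℕ}
    (hm : continuant a m = 0) (hn : continuant a n = 0) : ¬ m.Coprime n := by
  intro h
  have := continuant_gcd_eq_zero m n hm hn
  rw [h] at this
  exact one_ne_zero this

theorem not_coprime_of_continuant_mem {I : Ideal A} (hI : I ≠ ⊤) {a : A} {m n : ℕ}
    (hm : continuant a m ∈ I) (hn : continuant a n ∈ I) : ¬ m.Coprime n := by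
  have := Ideal.Quotient.nontrivial_iff.2 hI
  rw [← Ideal.Quotient.eq_zero_iff_mem, map_continuant] at hm hn
  exact not_coprime_of_continuant_eq_zero hm hn

theorem natDegree_continuant_X_le (n : ℕ) :
    (continuant (Polynomial.X : Polynomial A) (n + 1)).natDegree ≤ n := by
  induction n using Nat.twoStepInduction with
  | zero => simp [continuant]
  | one => simpa [continuant] using Polynomial.natDegree_X_le
  | more n ih₀ ih₁ =>
    rw [continuant]
    refine (Polynomial.natDegree_sub_le _ _).trans (max_le ?_ (by omega))
    refine Polynomial.natDegree_mul_le.trans ?_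
    have := Polynomial.natDegree_X_le (R := A)
    rw [Polynomial.natDegree_neg]
    omega

theorem coeff_continuant_X (n : ℕ) :
    (continuant (Polynomial.X : Polynomial A) (n + 1)).coeff n = (-1) ^ n := by
  induction n using Nat.twoStepInduction with
  | zero => simp [continuant]
  | one => simp [continuant]
  | more n _ ih₁ =>
    rw [continuant, neg_mul, Polynomial.coeff_sub, Polynomial.coeff_neg, Polynomial.coeff_X_mul,
      ih₁, Polynomial.coeff_eq_zero_of_natDegree_lt
        ((natDegree_continuant_X_le n).trans_lt (by omega))]
    ring

theorem natDegree_continuant_X [Nontrivial A] (n : ℕ) :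
    (continuant (Polynomial.X : Polynomial A) (n + 1)).natDegree = n := by
  refine (natDegree_continuant_X_le n).antisymm (Polynomial.le_natDegree_of_ne_zero ?_)
  rw [coeff_continuant_X]
  exact ((isUnit_one (M := A)).neg.pow n).ne_zero

end Continuant

variable (k : Type*) [Field k]

/-- The generators of `(u^q, v^q, w^q, x^q, y^q, z^q)` in the polynomial ring. -/
def powerGenerators (q : ℕ) : Set (MvPolynomial (Fin 7) k) :=
  {X 1 ^ q, X 2 ^ q, X 3 ^ q, X 4 ^ q, X 5 ^ q, X 6 ^ q}

theorem powerIdeal_eq_map (q : ℕ) :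
    powerIdeal k q =
      (Ideal.span (powerGenerators k q)).map (Ideal.Quotient.mk (Ideal.span {equation k})) := by
  rw [Ideal.map_span, powerIdeal, powerGenerators]
  simp only [Set.image_insert_eq, Set.image_singleton, map_pow, coord]

/-! ### A functional detecting M₁ -/

section Functional

variable {K : Type*} [CommRing K] [Algebra k K] (a : K)

/-- The weight of an exponent vector: `a^i sⱼ` on the monomials
`tⁱ u^(c+j) x^j v^(c+n-j) y^(n-j) w^(q-1)`, where `sⱼ` is the continuant sequence of `a` and
`q = c + n`; zero on all other monomials. -/
def weight (c n : ℕ) (d : Fin 7 →₀ ℕ) : K :=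
  if d 1 = c + d 4 ∧ d 2 = c + d 5 ∧ d 4 + d 5 = n ∧ d 3 + 1 = c + n ∧ d 6 = 0
  then a ^ d 0 * continuant a (d 4) else 0

/-- The `k`-linear functional on the polynomial ring given by `weight` on monomials. -/
noncomputable def weightFunctional (c n : ℕ) : MvPolynomial (Fin 7) k →ₗ[k] K :=
  (basisMonomials (Fin 7) k).constr k (weight a c n)

theorem weightFunctional_monomial (c n : ℕ) (d : Fin 7 →₀ ℕ) :
    weightFunctional k a c n (monomial d 1) = weight a c n d := by
  simpa [weightFunctional] using (basisMonomials (Fin 7) k).constr_basis k (weight a c n) d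

variable {k} in
theorem weightFunctional_mul_eq_zero {c n : ℕ} {g : MvPolynomial (Fin 7) k}
    (hg : ∀ d, weightFunctional k a c n (monomial d 1 * g) = 0) (f : MvPolynomial (Fin 7) k) :
    weightFunctional k a c n (f * g) = 0 := by
  induction f using MvPolynomial.induction_on' with
  | monomial d r =>
    have e : monomial d r = r • monomial d (1 : k) := by rw [smul_monomial, smul_eq_mul, mul_one]
    rw [e, smul_mul_assoc, map_smul, hg, smul_zero]
  | add p q hp hq => rw [add_mul, map_add, hp, hq, add_zero]

variable {c n : ℕ}

/-- On the support of the weight, a factor u^q or x^q forces the index j = n, and v^q or y^q forces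
j = 0, where sⱼ vanishes; w^q and z^q leave the support. -/
theorem weightFunctional_mul_power (hn : 0 < n) (ha : continuant a n = 0)
    {g : MvPolynomial (Fin 7) k} (hg : g ∈ powerGenerators k (c + n))
    (f : MvPolynomial (Fin 7) k) : weightFunctional k a c n (f * g) = 0 := by
  have ha₀ : continuant a 0 = 0 := rfl
  refine weightFunctional_mul_eq_zero a (fun d => ?_) f
  rcases hg with rfl | rfl | rfl | rfl | rfl | rfl <;>
  rw [X_pow_eq_monomial, monomial_mul, one_mul, weightFunctional_monomial, weight] <;>
  split_ifs with h
  all_goals try rfl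
  all_goals
    simp at h ⊢
  · rw [show d 4 = n by omega, ha, mul_zero]
  · rw [show d 4 = 0 by omega, ha₀, mul_zero]
  · omega
  · rw [show d 4 + (c + n) = n by omega, ha, mul_zero]
  · rw [show d 4 = 0 by omega, ha₀, mul_zero]
  · omega

theorem weightFunctional_mul_equation (f : MvPolynomial (Fin 7) k) :
    weightFunctional k a c n (f * equation k) = 0 := by
  refine weightFunctional_mul_eq_zero a (fun d => ?_) f
  have e : monomial d 1 * equation k =
      monomial (d + Finsupp.single 1 2 + Finsupp.single 4 2) 1 +
      monomial (d + Finsupp.single 2 2 + Finsupp.single 5 2) 1 +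
      monomial (d + Finsupp.single 0 1 + Finsupp.single 1 1 + Finsupp.single 4 1 +
        Finsupp.single 2 1 + Finsupp.single 5 1) 1 +
      monomial (d + Finsupp.single 0 1 + Finsupp.single 3 2 + Finsupp.single 6 2) 1 := by
    simp only [monomial_add_single, equation]
    ring
  rw [e]
  simp only [map_add, weightFunctional_monomial, weight]
  simp
  -- The first three terms lie in the support together or not at all, at indices j + 2, j and j + 1;
  -- the term with z² never does.
  by_cases h : d 1 + 2 = c + (d 4 + 2) ∧ d 2 = c + d 5 ∧ d 4 + 2 + d 5 = n ∧
      d 3 + 1 = c + n ∧ d 6 = 0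
  · rw [if_pos (by omega), if_pos (by omega), if_pos (by omega)]
    linear_combination a ^ d 0 * continuant_recurrence a (d 4)
  · rw [if_neg (by omega), if_neg (by omega), if_neg (by omega)]
    ring

variable {k} in
theorem weightFunctional_eq_zero_of_mem (hn : 0 < n) (ha : continuant a n = 0)
    {f : MvPolynomial (Fin 7) k}
    (hf : Ideal.Quotient.mk (Ideal.span {equation k}) f ∈ powerIdeal k (c + n)) :
    weightFunctional k a c n f = 0 := by
  rw [powerIdeal_eq_map, Ideal.mem_quotient_iff_mem_sup, ← Ideal.span_union] at hf
  suffices ∀ g, weightFunctional k a c n (g * f) = 0 by simpa using this 1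
  induction hf using Submodule.span_induction with
  | mem f hf =>
    intro g
    rcases hf with hf | rfl
    · exact weightFunctional_mul_power k a hn ha hf g
    · exact weightFunctional_mul_equation k a g
  | zero => simp
  | add f₁ f₂ _ _ h₁ h₂ => intro g; rw [mul_add, map_add, h₁, h₂, add_zero]
  | smul r f _ h => intro g; rw [smul_eq_mul, ← mul_assoc, h]

end Functional

/-! ### The chain of monomials and its annihilator -/

/-- The monomial `u^(c+j) x^j v^(c+i) y^i w^(c+n-1)`. -/
noncomputable def chainMonomial (c n j i : ℕ) : MvPolynomial (Fin 7) k :=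
  X 1 ^ (c + j) * X 4 ^ j * X 2 ^ (c + i) * X 5 ^ i * X 3 ^ (c + n - 1)

theorem chainMonomial_one_notMem_powerIdeal (c n : ℕ) :
    Ideal.Quotient.mk (Ideal.span {equation k}) (chainMonomial k c (n + 2) 1 (n + 1)) ∉
      powerIdeal k (c + (n + 2)) := by
  intro h
  -- Degree n + 1 > 0 keeps the quotient by `s` nonzero, so the value s₁ = 1 of the functional is
  -- nonzero.
  let s : Polynomial k := continuant Polynomial.X (n + 2)
  have : Nontrivial (AdjoinRoot s) := by
    apply AdjoinRoot.nontrivial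
    intro h
    have h' := Polynomial.natDegree_eq_of_degree_eq_some h
    rw [natDegree_continuant_X] at h'
    exact n.succ_ne_zero h'
  have hs : continuant (AdjoinRoot.root s) (n + 2) = 0 := by
    rw [← AdjoinRoot.mk_X, ← map_continuant (AdjoinRoot.mk s), AdjoinRoot.mk_self]
  have h₀ := weightFunctional_eq_zero_of_mem (AdjoinRoot.root s) (by omega) hs h
  have e : chainMonomial k c (n + 2) 1 (n + 1) =
      monomial (0 + Finsupp.single 1 (c + 1) + Finsupp.single 4 1 + Finsupp.single 2 (c + (n + 1))
        + Finsupp.single 5 (n + 1) + Finsupp.single 3 (c + (n + 2) - 1)) 1 := by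
    simp only [monomial_add_single, chainMonomial, pow_one]
    simp
  rw [e, weightFunctional_monomial, weight, if_pos] at h₀
  · simp [continuant] at h₀
  · simp
    omega

theorem chainMonomial_recurrence_mem (c n j i : ℕ) (h : i + j + 2 = n) :
    Ideal.Quotient.mk (Ideal.span {equation k})
      (chainMonomial k c n (j + 2) i + X 0 * chainMonomial k c n (j + 1) (i + 1) +
        chainMonomial k c n j (i + 2)) ∈ powerIdeal k (c + n) := by
  rw [powerIdeal_eq_map, Ideal.mem_quotient_iff_mem_sup]
  have e : chainMonomial k c n (j + 2) i + X 0 * chainMonomial k c n (j + 1) (i + 1) +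
      chainMonomial k c n j (i + 2) =
      -- The defect t w² z² meets w^(q-1), producing a multiple of w^q.
      -(X 1 ^ (c + j) * X 4 ^ j * X 2 ^ (c + i) * X 5 ^ i * X 0 * X 3 * X 6 ^ 2) * X 3 ^ (c + n) +
      (X 1 ^ (c + j) * X 4 ^ j * X 2 ^ (c + i) * X 5 ^ i * X 3 ^ (c + n - 1)) * equation k := by
    obtain ⟨N, hN⟩ : ∃ N, c + n = N + 1 := ⟨c + n - 1, by omega⟩
    simp only [chainMonomial, equation, hN, Nat.add_sub_cancel]
    ring
  rw [e]
  refine Submodule.add_mem_sup (Ideal.mul_mem_left _ _ (Ideal.subset_span ?_))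
    (Ideal.mul_mem_left _ _ (Ideal.mem_span_singleton_self _))
  simp [powerGenerators]

theorem mk_chainMonomial_mem_of_pow_mem (c n j i : ℕ) (h : n ≤ j ∨ n ≤ i) :
    Ideal.Quotient.mk (Ideal.span {equation k}) (chainMonomial k c n j i) ∈
      powerIdeal k (c + n) := by
  rw [powerIdeal_eq_map]
  apply Ideal.mem_map_of_mem
  rcases h with h | h
  · refine Ideal.mem_of_dvd _ (a := X 1 ^ (c + n)) ?_ (Ideal.subset_span (by simp [powerGenerators]))
    refine (pow_dvd_pow _ (by omega)).trans (b := X 1 ^ (c + j)) ?_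
    exact ⟨X 4 ^ j * X 2 ^ (c + i) * X 5 ^ i * X 3 ^ (c + n - 1), by rw [chainMonomial]; ring⟩
  · refine Ideal.mem_of_dvd _ (a := X 2 ^ (c + n)) ?_ (Ideal.subset_span (by simp [powerGenerators]))
    refine (pow_dvd_pow _ (by omega)).trans (b := X 2 ^ (c + i)) ?_
    exact ⟨X 1 ^ (c + j) * X 4 ^ j * X 5 ^ i * X 3 ^ (c + n - 1), by rw [chainMonomial]; ring⟩

theorem chainMonomial_sub_continuant_mul_mem (c n j : ℕ) (h : j + 1 ≤ n) :
    Ideal.Quotient.mk (Ideal.span {equation k})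
      (chainMonomial k c n (j + 1) (n - (j + 1)) -
        continuant (X 0) (j + 1) * chainMonomial k c n 1 (n - 1)) ∈ powerIdeal k (c + n) := by
  induction j using Nat.twoStepInduction with
  | zero => simp [continuant]
  | one =>
    have h₀ := mk_chainMonomial_mem_of_pow_mem k c n 0 n (.inr le_rfl)
    have h₁ := chainMonomial_recurrence_mem k c n 0 (n - 2) (by omega)
    rw [show n - 2 + 1 = n - 1 by omega, show n - 2 + 2 = n by omega] at h₁
    have e : chainMonomial k c n (1 + 1) (n - (1 + 1)) -
        continuant (X 0) (1 + 1) * chainMonomial k c n 1 (n - 1) =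
        chainMonomial k c n (0 + 2) (n - 2) + X 0 * chainMonomial k c n (0 + 1) (n - 1) +
          chainMonomial k c n 0 n - chainMonomial k c n 0 n := by
      simp only [continuant, zero_add, one_add_one_eq_two]
      ring
    rw [e, map_sub]
    exact sub_mem h₁ h₀
  | more j ih₀ ih₁ =>
    have h₀ := ih₀ (by omega)
    have h₁ := ih₁ (by omega)
    have h₂ := chainMonomial_recurrence_mem k c n (j + 1) (n - (j + 3)) (by omega)
    rw [show n - (j + 3) + 1 = n - (j + 2) by omega,
      show n - (j + 3) + 2 = n - (j + 1) by omega] at h₂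
    have h₃ := sub_mem (sub_mem h₂ h₀) (Ideal.mul_mem_left _
      (Ideal.Quotient.mk (Ideal.span {equation k}) (X 0)) h₁)
    rw [← map_mul, ← map_sub, ← map_sub] at h₃
    refine (congrArg (fun f => Ideal.Quotient.mk (Ideal.span {equation k}) f ∈ powerIdeal k (c + n))
      ?_).mp h₃
    linear_combination continuant_recurrence (X 0 : MvPolynomial (Fin 7) k) (j + 1) *
      chainMonomial k c n 1 (n - 1)

theorem continuant_mul_chainMonomial_one_mem (c n : ℕ) (hn : 0 < n) :
    continuant (coord k 0) n *
      Ideal.Quotient.mk (Ideal.span {equation k}) (chainMonomial k c n 1 (n - 1)) ∈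
        powerIdeal k (c + n) := by
  obtain ⟨j, rfl⟩ := Nat.exists_eq_succ_of_ne_zero hn.ne'
  have h₁ := chainMonomial_sub_continuant_mul_mem k c (j + 1) j le_rfl
  have h₀ := mk_chainMonomial_mem_of_pow_mem k c (j + 1) (j + 1) (j + 1 - (j + 1)) (.inl le_rfl)
  have h₂ := sub_mem h₀ h₁
  rwa [← map_sub, sub_sub_cancel, map_mul, map_continuant] at h₂

theorem exists_associatedPrime_continuant_mem (c n : ℕ) (hn : 2 ≤ n) :
    ∃ P ∈ associatedPrimes (HypersurfaceRing k) (HypersurfaceRing k ⧸ powerIdeal k (c + n)),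
      continuant (coord k 0) n ∈ P := by
  obtain ⟨n, rfl⟩ := Nat.exists_eq_add_of_le' hn
  let m := Ideal.Quotient.mk (Ideal.span {equation k}) (chainMonomial k c (n + 2) 1 (n + 1))
  have hm : Ideal.Quotient.mk (powerIdeal k (c + (n + 2))) m ≠ 0 := by
    rw [Ne, Ideal.Quotient.eq_zero_iff_mem]
    exact chainMonomial_one_notMem_powerIdeal k c n
  obtain ⟨P, hP, hle⟩ :=
    exists_le_isAssociatedPrime_of_isNoetherianRing (HypersurfaceRing k) _ hm
  refine ⟨P, hP, hle ?_⟩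
  rw [Submodule.mem_colon_singleton, Submodule.mem_bot]
  change Ideal.Quotient.mk (powerIdeal k (c + (n + 2))) (continuant (coord k 0) (n + 2) * m) = 0
  rw [Ideal.Quotient.eq_zero_iff_mem]
  exact continuant_mul_chainMonomial_one_mem k c (n + 2) (by omega)

/-! ### Maximality and infinitude -/

variable {k}

theorem coord_mem_of_mem_associatedPrimes {q : ℕ} {P : Ideal (HypersurfaceRing k)}
    (hP : P ∈ associatedPrimes (HypersurfaceRing k) (HypersurfaceRing k ⧸ powerIdeal k q))
    {i : Fin 7} (hi : i ≠ 0) : coord k i ∈ P := by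
  have hprime : P.IsPrime := IsAssociatedPrime.isPrime hP
  have hle : powerIdeal k q ≤ P := by
    have h := IsAssociatedPrime.annihilator_le hP
    rwa [Submodule.annihilator_top, Ideal.annihilator_quotient] at h
  refine hprime.mem_of_pow_mem q (hle (Ideal.subset_span ?_))
  fin_cases i <;> simp at hi ⊢

/-- The quotient by `P` is generated by t over k, hence is k[t] modulo a prime that contains `s` and
so is nonzero. -/
theorem isMaximal_of_coord_mem {P : Ideal (HypersurfaceRing k)} [P.IsPrime]
    (hP : ∀ i ≠ 0, coord k i ∈ P) {s : Polynomial k} (hs : s ≠ 0)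
    (hsP : Polynomial.aeval (coord k 0) s ∈ P) : P.IsMaximal := by
  let ψ : Polynomial k →ₐ[k] HypersurfaceRing k ⧸ P :=
    Polynomial.aeval (Ideal.Quotient.mkₐ k P (coord k 0))
  have hψ : Function.Surjective ψ := by
    intro b
    obtain ⟨r, rfl⟩ := Ideal.Quotient.mk_surjective b
    obtain ⟨f, rfl⟩ := Ideal.Quotient.mk_surjective r
    rw [← AlgHom.mem_range]
    induction f using MvPolynomial.induction_on with
    | C a => exact ⟨Polynomial.C a, by simp [ψ]; rfl⟩
    | add f g hf hg => rw [map_add, map_add]; exact add_mem hf hg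
    | mul_X f i hf =>
      rw [map_mul, map_mul]
      refine mul_mem hf ?_
      by_cases hi : i = 0
      · subst hi
        exact ⟨Polynomial.X, by simp [ψ]; rfl⟩
      · convert! zero_mem ψ.range
        exact Ideal.Quotient.eq_zero_iff_mem.2 (hP i hi)
  have hkerprime : (RingHom.ker ψ).IsPrime := RingHom.ker_isPrime ψ.toRingHom
  have hker : (RingHom.ker ψ).IsMaximal := by
    apply IsPrime.to_maximal_ideal
    intro h
    have : s ∈ RingHom.ker ψ := by
      rw [RingHom.mem_ker, Polynomial.aeval_algHom_apply]
      exact Ideal.Quotient.eq_zero_iff_mem.2 hsP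
    rw [h] at this
    exact hs this
  rw [← Ideal.bot_quotient_isMaximal_iff]
  have hmap : (RingHom.ker ψ).map ψ = ⊥ := by
    rw [Ideal.map_eq_bot_iff_le_ker]
  have := (Ideal.map_eq_top_or_isMaximal_of_surjective ψ hψ hker).resolve_left
    (by rw [hmap]; exact bot_ne_top)
  rwa [hmap] at this

theorem exists_maximal_mem_assUnion {p : ℕ} (hp : p.Prime) {n : ℕ} (hn : 2 ≤ n) :
    ∃ P : Ideal (HypersurfaceRing k), Maximal (fun Q => Q ∈ assUnion k p) P ∧
      P.IsPrime ∧ continuant (coord k 0) n ∈ P := by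
  -- Any exponent e with p^e ≥ n would do; e = n gives c = p^n - n.
  have hle : n ≤ p ^ n := (Nat.lt_pow_self hp.one_lt).le
  obtain ⟨P, hP, hs⟩ := exists_associatedPrime_continuant_mem k (p ^ n - n) n hn
  rw [Nat.sub_add_cancel hle] at hP
  have hprime : P.IsPrime := IsAssociatedPrime.isPrime hP
  have hmax : P.IsMaximal := by
    refine isMaximal_of_coord_mem (fun i hi => coord_mem_of_mem_associatedPrimes hP hi)
      (s := continuant Polynomial.X n) ?_ ?_
    · obtain ⟨n, rfl⟩ := Nat.exists_eq_add_of_le' hn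
      apply Polynomial.ne_zero_of_natDegree_gt (n := n)
      rw [natDegree_continuant_X]
      omega
    · have := map_continuant (Polynomial.aeval (R := k) (coord k 0)).toRingHom Polynomial.X n
      simp only [AlgHom.toRingHom_eq_coe, RingHom.coe_coe, Polynomial.aeval_X] at this
      rwa [this]
  refine ⟨P, ⟨Set.mem_iUnion.2 ⟨n, hP⟩, fun Q hQ hPQ => ?_⟩, hprime, hs⟩
  obtain ⟨e, he⟩ := Set.mem_iUnion.1 hQ
  exact (hmax.eq_of_le (IsAssociatedPrime.isPrime he).ne_top hPQ).ge

theorem infinite_maximal_assUnion {p : ℕ} (hp : p.Prime) :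
    {P : Ideal (HypersurfaceRing k) | Maximal (fun Q => Q ∈ assUnion k p) P}.Infinite := by
  choose P hmax hprime hs using fun l : Nat.Primes =>
    exists_maximal_mem_assUnion (k := k) hp l.2.two_le
  refine Set.infinite_of_injective_forall_mem (f := P) (fun l l' h => ?_) hmax
  by_contra hne
  have h₁ := hs l
  have h₂ := hs l'
  rw [← h] at h₂
  exact not_coprime_of_continuant_mem (hprime l).ne_top h₁ h₂
    ((Nat.coprime_primes l.2 l'.2).2 fun h => hne (Subtype.ext h))

end SinghSwanson

theorem mainTheorem6 (k : Type*) [Field k] (p : ℕ) (hp : p.Prime) [CharP k p] :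
    (SinghSwanson.assUnion k p).Infinite ∧
      {P : Ideal (SinghSwanson.HypersurfaceRing k) |
        Maximal (fun Q => Q ∈ SinghSwanson.assUnion k p) P}.Infinite :=
  have h := SinghSwanson.infinite_maximal_assUnion (k := k) hp
  ⟨h.mono fun _ hP => hP.prop, h⟩
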